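/- Let $(\Omega,\mathcal F,\mathsf P)$ be a complete probability space carrying a standard Brownian motion $W=(W_s)_{s\ge 0}$, and let $(\mathcal F_s)_{s\ge 0}$ be the filtration generated by $W$, augmented with the $\mathsf P$-null sets. For $t\in[0,1)$ and $x\in\mathbb R$ let $$X^{t,x}_s=(1-s)\Big(\frac{x}{1-t}+\int_t^s\frac{\mathrm dW_u}{1-u}\Big)\quad (t\le s<1),\qquad X^{t,x}_1=0,$$ be the Brownian bridge started from $x$ at time $t$ and pinned at $0$ at time $1$ (that is, the solution of $\mathrm dX_s=-\frac{X_s}{1-s}\,\mathrm ds+\mathrm dW_s$, $X_t=x$), and let $X^{1,x}_1=x$. For $(t,x)\in[0,1]\times\mathbb R$ put $$v(t,x)=\sup_{0\le\tau\le 1-t}\mathsf E\big[e^{X^{t,x}_{t+\tau}}\big],$$ where the supremum is over all random times $\tau$ with values in $[0,1-t]$ such that $t+\tau$ is an $(\mathcal F_s)$-stopping time. Let $S_1=\sup_{0\le s\le 1}|W_s|$ and $c_1=\mathsf E[e^{S_1}]$. Then $c_1<\infty$ and $v(t,x)<\infty$ for all $(t,x)\in[0,1]\times\mathbb R$, and: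 1. for every $t\in[0,1]$ the map $x\mapsto v(t,x)$ is convex and non-decreasing on $\mathbb R$; 2. for every compact set $K\subset\mathbb R$ there exists $L_K>0$ such that $$\sup_{t\in[0,1]}|v(t,y)-v(t,x)|\le L_K\,|y-x|\qquad\text{for all }x,y\in K,$$ and, if $K\neq\emptyset$, one can take $L_K=c_1\max_{z\in K}e^{|z|}$. -/

import Mathlib

open MeasureTheory ProbabilityTheory
open scoped NNReal ENNReal

namespace BridgeStopping

variable {Ω : Type*} {mΩ : MeasurableSpace Ω}

/-- The filtration generated by a Brownian motion `W` on a complete probability space, augmented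
with the `P`-null sets. -/
def augmentedFiltration {P : Measure Ω} [P.IsComplete] {W : ℝ≥0 → Ω → ℝ}
    (hW : IsBrownianReal W P) : Filtration ℝ≥0 mΩ where
  seq s := (⨆ u ≤ s, MeasurableSpace.comap (W u) inferInstance) ⊔
    MeasurableSpace.generateFrom {N : Set Ω | P N = 0}
  mono' _ _ hij := sup_le_sup_right (biSup_mono fun _ h => h.trans hij) _
  le' s := by
    refine sup_le (iSup₂_le fun u _ => ?_) (MeasurableSpace.generateFrom_le fun N hN => ?_)
    · exact ((hW.toIsPreBrownianReal.aemeasurable u).nullMeasurable.measurable_of_complete).comap_le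
    · exact Measure.IsComplete.out' N hN

/-- The Wiener integral `∫_t^s f(u) dW_u` of a deterministic continuously differentiable integrand,
defined pathwise by integration by parts (the Paley–Wiener integral). -/
noncomputable def wienerIntegral (W : ℝ≥0 → Ω → ℝ) (f : ℝ → ℝ) (t s : ℝ≥0) (ω : Ω) : ℝ :=
  f s * W s ω - f t * W t ω - ∫ u in (t : ℝ)..s, deriv f u * W u.toNNReal ω

/-- The Brownian bridge `X^{t,x}_s`, started from `x` at time `t` and pinned at `0` at time `1`:
`X^{t,x}_s = (1 - s) (x / (1 - t) + ∫_t^s dW_u / (1 - u))` for `t < 1`, and `X^{1,x}_1 = x`. -/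
noncomputable def brownianBridge (W : ℝ≥0 → Ω → ℝ) (t : ℝ≥0) (x : ℝ) (s : ℝ≥0) (ω : Ω) : ℝ :=
  if t < 1 then
    (1 - (s : ℝ)) * (x / (1 - (t : ℝ)) + wienerIntegral W (fun u => (1 - u)⁻¹) t s ω)
  else x

theorem brownianBridge_one (W : ℝ≥0 → Ω → ℝ) {t : ℝ≥0} (ht : t < 1) (x : ℝ) (ω : Ω) :
    brownianBridge W t x 1 ω = 0 := by
  simp [brownianBridge, ht]

theorem brownianBridge_start (W : ℝ≥0 → Ω → ℝ) (t : ℝ≥0) (x : ℝ) (ω : Ω) :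
    brownianBridge W t x t ω = x := by
  unfold brownianBridge
  split_ifs with ht
  · have : (1 : ℝ) - t ≠ 0 := by
      have : (t : ℝ) < 1 := by exact_mod_cast ht
      linarith
    simp [wienerIntegral]
    field_simp
  · rfl

/-- On every continuous path, the bridge solves `dX_s = - X_s / (1 - s) ds + dW_s`, `X_t = x`. -/
theorem brownianBridge_sde (W : ℝ≥0 → Ω → ℝ) (ω : Ω) (hc : Continuous (W · ω))
    {t s : ℝ≥0} (hts : t ≤ s) (hs : s < 1) (x : ℝ) :
    brownianBridge W t x s ω =
      x - (∫ u in (t : ℝ)..s, brownianBridge W t x u.toNNReal ω / (1 - u)) + (W s ω - W t ω) := by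
  have hs' : (s : ℝ) < 1 := by exact_mod_cast hs
  have hts' : (t : ℝ) ≤ s := by exact_mod_cast hts
  have ht : t < 1 := hts.trans_lt hs
  set w : ℝ → ℝ := fun u => W u.toNNReal ω with hw
  have hwc : Continuous w := hc.comp continuous_real_toNNReal
  have hwr : ∀ r : ℝ≥0, W r ω = w r := fun r => by simp [hw]
  have hd : ∀ u : ℝ, deriv (fun u : ℝ => (1 - u)⁻¹) u = ((1 - u) ^ 2)⁻¹ := fun u => by
    have h := deriv_comp_const_sub (fun y : ℝ => y⁻¹) 1 u
    rw [h, deriv_inv]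
    simp
  have hgc : ContinuousOn (fun u => ((1 - u) ^ 2)⁻¹ * w u) (Set.Iio 1) := by
    refine ContinuousOn.mul (ContinuousOn.inv₀ (by fun_prop) fun u hu => ?_) hwc.continuousOn
    exact pow_ne_zero _ (sub_ne_zero.2 (ne_of_gt hu))
  set J : ℝ → ℝ := fun r => ∫ u in (t : ℝ)..r, ((1 - u) ^ 2)⁻¹ * w u with hJ
  have hsub : ∀ r : ℝ, (t : ℝ) ≤ r → r < 1 → Set.uIcc (t : ℝ) r ⊆ Set.Iio 1 := fun r h h1 u hu => by
    rw [Set.uIcc_of_le h] at hu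
    exact hu.2.trans_lt h1
  have hJd : ∀ r : ℝ, (t : ℝ) ≤ r → r < 1 → HasDerivAt J (((1 - r) ^ 2)⁻¹ * w r) r := fun r h h1 =>
    intervalIntegral.integral_hasDerivAt_right
      ((hgc.mono (hsub r h h1)).intervalIntegrable)
      (hgc.stronglyMeasurableAtFilter isOpen_Iio r h1)
      (hgc.continuousAt (isOpen_Iio.mem_nhds h1))
  set c : ℝ := x / (1 - (t : ℝ)) - (1 - (t : ℝ))⁻¹ * w t with hcdef
  have hX : ∀ r : ℝ, (t : ℝ) ≤ r → r < 1 → brownianBridge W t x r.toNNReal ω =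
      (1 - r) * (c + (1 - r)⁻¹ * w r - J r) := fun r h h1 => by
    have hr : ((r.toNNReal : ℝ≥0) : ℝ) = r := Real.coe_toNNReal r (t.2.trans h)
    have hwu : ∀ u : ℝ, W u.toNNReal ω = w u := fun _ => rfl
    simp only [brownianBridge, if_pos ht, wienerIntegral, hd, hr, hwu]
    rw [hwr t, hcdef, hJ]
    ring
  have hY : ∀ r : ℝ, (t : ℝ) ≤ r → r < 1 → HasDerivAt (fun r => (1 - r) * (c - J r))
      (-(brownianBridge W t x r.toNNReal ω / (1 - r))) r := fun r h h1 => by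
    have h0 : (1 : ℝ) - r ≠ 0 := by linarith
    have h2 := ((hasDerivAt_id r).const_sub 1).mul ((hJd r h h1).const_sub c)
    refine h2.congr_deriv ?_
    rw [hX r h h1]
    simp only [id]
    field_simp
    ring
  have hint : IntervalIntegrable
      (fun r : ℝ => -(brownianBridge W t x r.toNNReal ω / (1 - r))) volume t s := by
    refine (ContinuousOn.congr (f := fun r => -(c + (1 - r)⁻¹ * w r - J r)) ?_ ?_).intervalIntegrable
    · have hJc : ContinuousOn J (Set.uIcc (t : ℝ) s) := fun r hr =>
        (hJd r (by rw [Set.uIcc_of_le hts'] at hr; exact hr.1)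
          (hsub s hts' hs' hr)).continuousAt.continuousWithinAt
      refine ((continuousOn_const.add (ContinuousOn.mul
        (ContinuousOn.inv₀ (by fun_prop) fun u hu => ?_) hwc.continuousOn)).sub hJc).neg
      exact sub_ne_zero.2 (ne_of_gt (hsub s hts' hs' hu))
    · intro r hr
      have h1 : r < 1 := hsub s hts' hs' hr
      rw [Set.uIcc_of_le hts'] at hr
      have h0 : (1 : ℝ) - r ≠ 0 := by linarith
      simp only [hX r hr.1 h1]
      field_simp
  have hftc := intervalIntegral.integral_eq_sub_of_hasDerivAt (fun r hr => hY r
    (by rw [Set.uIcc_of_le hts'] at hr; exact hr.1) (hsub s hts' hs' hr)) hint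
  rw [intervalIntegral.integral_neg] at hftc
  have hXs := hX s hts' hs'
  rw [Real.toNNReal_coe] at hXs
  have hJt : J t = 0 := by simp [hJ]
  have h0 : (1 : ℝ) - s ≠ 0 := by linarith
  have h0t : (1 : ℝ) - t ≠ 0 := by linarith
  have e1 : (1 - (s : ℝ)) * (c + (1 - (s : ℝ))⁻¹ * w s - J s) =
      (1 - (s : ℝ)) * (c - J s) + w s := by field_simp; ring
  have e2 : (1 - (t : ℝ)) * (c - J t) = x - w t := by rw [hJt, hcdef]; field_simp; ring
  rw [hXs, hwr, hwr]
  linarith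

/-- `τ` is an admissible random time for the problem started at time `t`: `0 ≤ τ ≤ 1 - t` and
`t + τ` is a stopping time of the augmented Brownian filtration. -/
def IsAdmissible {P : Measure Ω} [P.IsComplete] {W : ℝ≥0 → Ω → ℝ}
    (hW : IsBrownianReal W P) (t : ℝ≥0) (τ : Ω → ℝ≥0) : Prop :=
  (∀ ω, t + τ ω ≤ 1) ∧
    IsStoppingTime (augmentedFiltration hW) (fun ω => ((t + τ ω : ℝ≥0) : WithTop ℝ≥0))

/-- `sup_τ E[exp(X^{t,x}_{t+τ})]` over the admissible `τ`, as an element of `[0, ∞]`. -/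
noncomputable def extendedValue {P : Measure Ω} [P.IsComplete] {W : ℝ≥0 → Ω → ℝ}
    (hW : IsBrownianReal W P) (t : ℝ≥0) (x : ℝ) : ℝ≥0∞ :=
  ⨆ (τ : Ω → ℝ≥0) (_ : IsAdmissible hW t τ),
    ∫⁻ ω, ENNReal.ofReal (Real.exp (brownianBridge W t x (t + τ ω) ω)) ∂P

/-- The value function `v(t,x)`, a real number wherever `extendedValue` is finite. -/
noncomputable def value {P : Measure Ω} [P.IsComplete] {W : ℝ≥0 → Ω → ℝ}
    (hW : IsBrownianReal W P) (t : ℝ≥0) (x : ℝ) : ℝ :=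
  (extendedValue hW t x).toReal

/-- `S_1 = sup_{0 ≤ s ≤ 1} |W_s|`. -/
noncomputable def supAbs (W : ℝ≥0 → Ω → ℝ) (ω : Ω) : ℝ :=
  ⨆ s : Set.Icc (0 : ℝ≥0) 1, |W s ω|

/-- `c_1 = E[exp(S_1)]`. -/
noncomputable def c₁ (W : ℝ≥0 → Ω → ℝ) (P : Measure Ω) : ℝ :=
  ∫ ω, Real.exp (supAbs W ω) ∂P

end BridgeStopping

namespace BridgeStopping

open Filter Topology

variable {Ω : Type*} {mΩ : MeasurableSpace Ω}

/-! The bridge is affine in its starting point: `X^{t,x}_s = r x + X^{t,0}_s` with `r = (1-s)/(1-t)`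
in `[0,1]` (`brownianBridge_eq`). For a fixed random time the gain is therefore an average of `exp
(r x)` with nonnegative weights, hence convex and nondecreasing in `x`, and both properties survive
the supremum. For `x ≤ y`, convexity of `exp` gives `exp (r y) - exp (r x) ≤ exp |y| (y - x)`; using
at `x` the random times that are admissible at `y` yields the Lipschitz estimate, provided `E[exp
X^{t,0}_σ] ≤ c₁` for every `[t,1]`-valued time `σ`.

That uniform bound does not come from a pathwise comparison with `S_1`. The bridge is `1-s` times a
Wiener integral of variance `1/(1-s) - 1/(1-t)`. Doob's maximal inequality for exponential
martingales, applied to step-function approximations, gives its maximum the tail `exp (-2a²)`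
whatever `t` is. Integrating the tail and passing to the limit with Fatou bounds the exponential
moment by `1 + e^{1/4} √π/2` (`lintegral_exp_bridge_zero_le`). On the other side `c₁ ≥ 1 + E|W_1| +
E[W_1²]/2`, and a numerical comparison closes the gap (`le_c₁`). The same tail estimate for `W` and
`-W` shows that `c₁` is finite. -/

/-! ### Exponential martingales of step integrals. -/

/-- The integral of the step function with values `c i` on `(u i, u (i + 1)]` against `W`. -/
def stepIntegral (W : ℝ≥0 → Ω → ℝ) (u : ℕ → ℝ≥0) (c : ℕ → ℝ) (k : ℕ) (ω : Ω) : ℝ :=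
  ∑ i ∈ Finset.range k, c i * (W (u (i + 1)) ω - W (u i) ω)

/-- The variance of `stepIntegral` for a Brownian motion. -/
def stepVariance (u : ℕ → ℝ≥0) (c : ℕ → ℝ) (k : ℕ) : ℝ :=
  ∑ i ∈ Finset.range k, c i ^ 2 * ((u (i + 1) : ℝ) - u i)

/-- The exponential martingale of `stepIntegral`. -/
noncomputable def stepExponential (W : ℝ≥0 → Ω → ℝ) (u : ℕ → ℝ≥0) (c : ℕ → ℝ) (k : ℕ) (ω : Ω) : ℝ :=
  Real.exp (stepIntegral W u c k ω - stepVariance u c k / 2)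

theorem measurable_of_isPreBrownianReal {P : Measure Ω} [P.IsComplete] {W : ℝ≥0 → Ω → ℝ}
    (hW : IsPreBrownianReal W P) (s : ℝ≥0) : Measurable (W s) :=
  (hW.aemeasurable s).nullMeasurable.measurable_of_complete

/-- The natural filtration of `W` sampled along the times `u`. -/
def sampledFiltration {P : Measure Ω} [P.IsComplete] {W : ℝ≥0 → Ω → ℝ}
    (hW : IsPreBrownianReal W P) (u : ℕ → ℝ≥0) (hu : Monotone u) : Filtration ℕ mΩ where
  seq k := MeasurableSpace.comap (fun ω (r : Set.Iic (u k)) => W r ω) inferInstance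
  mono' i j hij := by
    have h : (fun ω (r : Set.Iic (u i)) => W r ω) =
        (fun (g : Set.Iic (u j) → ℝ) (r : Set.Iic (u i)) => g ⟨r, r.2.trans (hu hij)⟩) ∘
          (fun ω (r : Set.Iic (u j)) => W r ω) := rfl
    beta_reduce
    rw [h, ← MeasurableSpace.comap_comp]
    exact MeasurableSpace.comap_mono (Measurable.comap_le (by fun_prop))
  le' k := Measurable.comap_le
    (measurable_pi_lambda _ fun r : Set.Iic (u k) => measurable_of_isPreBrownianReal hW r)

theorem measurable_sampledFiltration {P : Measure Ω} [P.IsComplete] {W : ℝ≥0 → Ω → ℝ}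
    (hW : IsPreBrownianReal W P) (u : ℕ → ℝ≥0) (hu : Monotone u) {k : ℕ} {r : ℝ≥0} (hr : r ≤ u k) :
    Measurable[sampledFiltration hW u hu k] (W r) :=
  (measurable_pi_apply (X := fun _ => ℝ) (⟨r, hr⟩ : Set.Iic (u k))).comp
    (comap_measurable (fun ω (r : Set.Iic (u k)) => W r ω))

theorem stepExponential_succ (W : ℝ≥0 → Ω → ℝ) (u : ℕ → ℝ≥0) (c : ℕ → ℝ) (k : ℕ) :
    stepExponential W u c (k + 1) = stepExponential W u c k * fun ω =>
      Real.exp (c k * (W (u (k + 1)) ω - W (u k) ω)) *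
        Real.exp (-(c k ^ 2 * ((u (k + 1) : ℝ) - u k) / 2)) := by
  ext ω
  simp only [stepExponential, stepIntegral, stepVariance, Finset.sum_range_succ, Pi.mul_apply,
    ← Real.exp_add]
  congr 1
  ring

theorem stronglyAdapted_stepExponential {P : Measure Ω} [P.IsComplete] {W : ℝ≥0 → Ω → ℝ}
    (hW : IsPreBrownianReal W P) (u : ℕ → ℝ≥0) (hu : Monotone u) (c : ℕ → ℝ) :
    StronglyAdapted (sampledFiltration hW u hu) (stepExponential W u c) := fun k => by
  refine (Measurable.stronglyMeasurable ?_)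
  refine Real.measurable_exp.comp (Measurable.sub_const ?_ _)
  refine Finset.measurable_fun_sum _ fun i hi => Measurable.const_mul ?_ _
  have hi' := Finset.mem_range.1 hi
  exact (measurable_sampledFiltration hW u hu (hu hi')).sub
    (measurable_sampledFiltration hW u hu (hu hi'.le))

theorem stepExponential_factor {P : Measure Ω} [IsProbabilityMeasure P]
    {W : ℝ≥0 → Ω → ℝ} (hW : IsPreBrownianReal W P) {r s : ℝ≥0} (hrs : r ≤ s) (a : ℝ) :
    Integrable (fun ω => Real.exp (a * (W s ω - W r ω)) *
        Real.exp (-(a ^ 2 * ((s : ℝ) - r) / 2))) P ∧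
      ∫ ω, Real.exp (a * (W s ω - W r ω)) * Real.exp (-(a ^ 2 * ((s : ℝ) - r) / 2)) ∂P = 1 := by
  have hlaw := hW.hasLaw_sub s r
  have hmap := hlaw.map_eq
  have hmgf := mgf_gaussianReal hmap a
  have hi : Integrable (fun ω => Real.exp (a * (W s ω - W r ω))) P := by
    have := integrable_exp_mul_gaussianReal (μ := 0) (v := nndist s.1 r.1) a
    rw [← hmap] at this
    exact this.comp_aemeasurable hlaw.aemeasurable
  refine ⟨hi.mul_const _, ?_⟩
  rw [integral_mul_const]
  have h2 : ∫ ω, Real.exp (a * (W s ω - W r ω)) ∂P = mgf (W s - W r) P a := rfl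
  have h3 : ((nndist s.1 r.1 : ℝ≥0) : ℝ) = s - r := by
    rw [coe_nndist, Real.dist_eq, abs_of_nonneg]
    · rfl
    · exact sub_nonneg.2 hrs
  rw [h2, hmgf, h3, ← Real.exp_add, Real.exp_eq_one_iff]
  ring

/-- The Markov property: the path restarted at `u k` is independent of the whole past up to `u k`,
which is why the sampled σ-algebras contain all earlier times and not only the sample points. -/
theorem indep_increment_sampledFiltration {P : Measure Ω} [P.IsComplete]
    {W : ℝ≥0 → Ω → ℝ} (hW : IsPreBrownianReal W P) (u : ℕ → ℝ≥0) (hu : Monotone u) (k : ℕ) :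
    Indep (MeasurableSpace.comap (fun ω => W (u (k + 1)) ω - W (u k) ω) inferInstance)
      (sampledFiltration hW u hu k) P := by
  have h := (hW.indepFun_shift (u k)).comp
    (measurable_pi_apply (X := fun _ => ℝ) (u (k + 1) - u k)) measurable_id
  have e : ((fun g : ℝ≥0 → ℝ => g (u (k + 1) - u k)) ∘ fun ω t => W (u k + t) ω - W (u k) ω) =
      fun ω => W (u (k + 1)) ω - W (u k) ω := by
    ext ω
    change W (u k + (u (k + 1) - u k)) ω - W (u k) ω = _
    rw [add_tsub_cancel_of_le (hu k.le_succ)]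
  rw [e] at h
  exact (IndepFun_iff_Indep _ _ _).1 h

/-- Each new factor is independent of the past and has mean one by the Gaussian moment generating
function; independence also gives integrability of the product. -/
theorem martingale_stepExponential {P : Measure Ω} [IsProbabilityMeasure P] [P.IsComplete]
    {W : ℝ≥0 → Ω → ℝ} (hW : IsPreBrownianReal W P) (u : ℕ → ℝ≥0) (hu : Monotone u) (c : ℕ → ℝ) :
    Martingale (stepExponential W u c) (sampledFiltration hW u hu) P := by
  have hadp := stronglyAdapted_stepExponential hW u hu c
  have hsm : ∀ k, StronglyMeasurable[MeasurableSpace.comap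
      (fun ω => W (u (k + 1)) ω - W (u k) ω) inferInstance]
      fun ω => Real.exp (c k * (W (u (k + 1)) ω - W (u k) ω)) *
        Real.exp (-(c k ^ 2 * ((u (k + 1) : ℝ) - u k) / 2)) := fun k => by
    have h1 : Measurable fun y : ℝ => Real.exp (c k * y) *
        Real.exp (-(c k ^ 2 * ((u (k + 1) : ℝ) - u k) / 2)) := by fun_prop
    exact (h1.comp (comap_measurable _)).stronglyMeasurable
  have hle : ∀ k, MeasurableSpace.comap
      (fun ω => W (u (k + 1)) ω - W (u k) ω) inferInstance ≤ mΩ := fun k =>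
    ((measurable_of_isPreBrownianReal hW _).sub (measurable_of_isPreBrownianReal hW _)).comap_le
  have hint : ∀ k, Integrable (stepExponential W u c k) P := fun k => by
    induction k with
    | zero =>
      have h : stepExponential W u c 0 = fun _ => 1 := by
        ext ω
        simp [stepExponential, stepIntegral, stepVariance]
      exact h ▸ integrable_const 1
    | succ k ih =>
      rw [stepExponential_succ]
      refine IndepFun.integrable_mul ?_ ih (stepExponential_factor hW (hu k.le_succ) _).1
      rw [IndepFun_iff_Indep]
      exact indep_of_indep_of_le_left (indep_of_indep_of_le_right
        (indep_increment_sampledFiltration hW u hu k).symm (hsm k).measurable.comap_le)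
        (hadp k).measurable.comap_le
  refine martingale_nat hadp hint fun k => ?_
  have hf := stepExponential_factor hW (hu k.le_succ) (c k)
  have h1 := condExp_mul_of_stronglyMeasurable_left (hadp k)
    (by rw [← stepExponential_succ]; exact hint (k + 1)) hf.1
  have h2 := condExp_indep_eq (hle k) ((sampledFiltration hW u hu).le k) (hsm k)
    (indep_increment_sampledFiltration hW u hu k)
  rw [hf.2] at h2
  rw [stepExponential_succ]
  filter_upwards [h1, h2] with ω h1 h2
  rw [h1, Pi.mul_apply, h2, mul_one]

/-- Doob's maximal inequality at level `exp β` for a positive martingale of mean one. -/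
theorem measure_exists_le_stepIntegral_sub {P : Measure Ω} [IsProbabilityMeasure P] [P.IsComplete]
    {W : ℝ≥0 → Ω → ℝ} (hW : IsPreBrownianReal W P) (u : ℕ → ℝ≥0) (hu : Monotone u) (c : ℕ → ℝ)
    (n : ℕ) (β : ℝ) :
    P {ω | ∃ k ≤ n, β ≤ stepIntegral W u c k ω - stepVariance u c k / 2} ≤
      ENNReal.ofReal (Real.exp (-β)) := by
  have hm := martingale_stepExponential hW u hu c
  have h := maximal_ineq hm.submartingale (fun k ω => (Real.exp_pos _).le)
    (ε := (Real.exp β).toNNReal) n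
  have hone : ∀ k, ∫ ω, stepExponential W u c k ω ∂P = 1 := fun k => by
    have h1 := hm.setIntegral_eq (Nat.zero_le k) MeasurableSet.univ
    simp only [Measure.restrict_univ] at h1
    rw [← h1]
    simp [stepExponential, stepIntegral, stepVariance]
  have hset : {ω | ((Real.exp β).toNNReal : ℝ) ≤ (Finset.range (n + 1)).sup'
      Finset.nonempty_range_add_one fun k => stepExponential W u c k ω} =
      {ω | ∃ k ≤ n, β ≤ stepIntegral W u c k ω - stepVariance u c k / 2} := by
    ext ω
    simp [Finset.le_sup'_iff, stepExponential, Real.coe_toNNReal _ (Real.exp_pos β).le]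
  rw [hset] at h
  have hle : ∫ ω in {ω | ∃ k ≤ n, β ≤ stepIntegral W u c k ω - stepVariance u c k / 2},
      stepExponential W u c n ω ∂P ≤ 1 := by
    rw [← hone n]
    exact setIntegral_le_integral (hm.integrable n) (ae_of_all _ fun ω => (Real.exp_pos _).le)
  have h3 : ENNReal.ofReal (Real.exp β) *
      P {ω | ∃ k ≤ n, β ≤ stepIntegral W u c k ω - stepVariance u c k / 2} ≤ 1 :=
    h.trans (ENNReal.ofReal_le_one.2 hle)
  rw [Real.exp_neg, ENNReal.ofReal_inv_of_pos (Real.exp_pos _), ENNReal.le_inv_iff_mul_le, mul_comm]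
  exact h3

/-! ### Gaussian tails and exponential moments of maxima. -/

/-- The maximum of a step integral scaled by the weights `d` has Gaussian tails. -/
theorem measure_le_sup_stepIntegral {P : Measure Ω} [IsProbabilityMeasure P] [P.IsComplete]
    {W : ℝ≥0 → Ω → ℝ} (hW : IsPreBrownianReal W P) (u : ℕ → ℝ≥0) (hu : Monotone u) (c d : ℕ → ℝ)
    (n : ℕ) {b l : ℝ} (hl : 0 ≤ l) (hd : ∀ k ≤ n, 0 < d k)
    (hb : ∀ k ≤ n, b ≤ l / d k - l ^ 2 * stepVariance u c k / 2) {a : ℝ} (ha : 0 < a) :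
    P {ω | a ≤ (Finset.range (n + 1)).sup' Finset.nonempty_range_add_one
      fun k => d k * stepIntegral W u c k ω} ≤ ENNReal.ofReal (Real.exp (-(b * a ^ 2))) := by
  -- Take the exponential martingale with parameter `l * a`. If the `k`-th scaled integral reaches
  -- `a`, the logarithm of the martingale is at least `a² (l / d k - l² V k / 2)`, with `V k` the
  -- variance, and `hb` bounds this below by `b a²`.
  refine (measure_mono fun ω hω => ?_).trans
    (measure_exists_le_stepIntegral_sub hW u hu (fun i => l * a * c i) n (b * a ^ 2))
  simp only [Set.mem_ofPred_eq, Finset.le_sup'_iff, Finset.mem_range, Nat.lt_succ_iff] at hω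
  obtain ⟨k, hk, hak⟩ := hω
  refine ⟨k, hk, ?_⟩
  have e1 : stepIntegral W u (fun i => l * a * c i) k ω = l * a * stepIntegral W u c k ω := by
    simp only [stepIntegral, Finset.mul_sum, mul_assoc]
  have e2 : stepVariance u (fun i => l * a * c i) k = (l * a) ^ 2 * stepVariance u c k := by
    simp only [stepVariance, Finset.mul_sum]
    exact Finset.sum_congr rfl fun i _ => by ring
  have h1 : a / d k ≤ stepIntegral W u c k ω := by
    rw [div_le_iff₀ (hd k hk)]
    linarith
  have h2 := mul_le_mul_of_nonneg_left h1 (mul_nonneg hl ha.le)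
  have h3 := mul_le_mul_of_nonneg_right (hb k hk) (sq_nonneg a)
  have h4 : l * a * (a / d k) = l / d k * a ^ 2 := by ring
  rw [e1, e2]
  nlinarith

/-- Layer-cake formula: `E[exp M] = 1 + ∫ exp a P(M ≥ a) da` over `a > 0`. -/
theorem lintegral_exp_le_of_gaussian_tail {P : Measure Ω} [IsProbabilityMeasure P] {M : Ω → ℝ}
    (hM : AEMeasurable M P) (h0 : 0 ≤ M) {b : ℝ} (hb : 0 < b)
    (h : ∀ a : ℝ, 0 < a → P {ω | a ≤ M ω} ≤ ENNReal.ofReal (Real.exp (-(b * a ^ 2)))) :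
    ∫⁻ ω, ENNReal.ofReal (Real.exp (M ω)) ∂P ≤
      ENNReal.ofReal (1 + Real.exp (1 / (2 * b)) * (√(Real.pi / (b / 2)) / 2)) := by
  have h1 := lintegral_comp_eq_lintegral_meas_le_mul P (f := M) (g := Real.exp)
    (ae_of_all _ h0) hM (fun t _ => Real.continuous_exp.intervalIntegrable _ _)
    (ae_of_all _ fun t => (Real.exp_pos t).le)
  simp only [integral_exp, Real.exp_zero] at h1
  have h2 : ∀ ω, ENNReal.ofReal (Real.exp (M ω)) = 1 + ENNReal.ofReal (Real.exp (M ω) - 1) :=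
    fun ω => by
      rw [← ENNReal.ofReal_one, ← ENNReal.ofReal_add zero_le_one, add_sub_cancel]
      exact sub_nonneg.2 (Real.one_le_exp (h0 ω))
  simp_rw [h2]
  rw [lintegral_add_left measurable_const, h1, ENNReal.ofReal_add zero_le_one (by positivity)]
  simp only [lintegral_const, measure_univ, mul_one, ENNReal.ofReal_one]
  refine add_le_add_right ?_ 1
  have hint : Integrable (fun a : ℝ => Real.exp (1 / (2 * b)) * Real.exp (-(b / 2) * a ^ 2))
      (volume.restrict (Set.Ioi 0)) :=
    ((integrable_exp_neg_mul_sq (half_pos hb)).const_mul _).restrict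
  rw [← integral_gaussian_Ioi, ← integral_const_mul,
    ofReal_integral_eq_lintegral_ofReal hint (ae_of_all _ fun a => by positivity)]
  refine lintegral_mono_ae ((ae_restrict_iff' measurableSet_Ioi).2 (ae_of_all _ fun a ha => ?_))
  refine (mul_le_mul_left (h a ha) _).trans ?_
  rw [← ENNReal.ofReal_mul (Real.exp_pos _).le, ← Real.exp_add, ← Real.exp_add]
  refine ENNReal.ofReal_le_ofReal (Real.exp_le_exp.2 ?_)
  -- Half of the Gaussian exponent absorbs the linear term `a` by completing the square; the other
  -- half leaves a centred Gaussian integral over the half-line.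
  have e : 1 / (2 * b) + -(b / 2) * a ^ 2 - (-(b * a ^ 2) + a) = (b * a - 1) ^ 2 / (2 * b) := by
    field_simp
    ring
  have : 0 ≤ (b * a - 1) ^ 2 / (2 * b) := by positivity
  linarith

theorem measurable_sup_stepIntegral {P : Measure Ω} [P.IsComplete] {W : ℝ≥0 → Ω → ℝ}
    (hW : IsPreBrownianReal W P) (u : ℕ → ℝ≥0) (c d : ℕ → ℝ) (n : ℕ) :
    Measurable fun ω => (Finset.range (n + 1)).sup' Finset.nonempty_range_add_one
      fun k => d k * stepIntegral W u c k ω := by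
  have : Measurable ((Finset.range (n + 1)).sup' Finset.nonempty_range_add_one
      fun k ω => d k * stepIntegral W u c k ω) := by
    refine Finset.measurable_sup' _ fun k _ => Measurable.const_mul ?_ _
    exact Finset.measurable_fun_sum _ fun i _ => ((measurable_of_isPreBrownianReal hW _).sub
      (measurable_of_isPreBrownianReal hW _)).const_mul _
  convert this using 1
  ext ω
  simp

theorem lintegral_exp_sup_stepIntegral_le {P : Measure Ω} [IsProbabilityMeasure P] [P.IsComplete]
    {W : ℝ≥0 → Ω → ℝ} (hW : IsPreBrownianReal W P) (u : ℕ → ℝ≥0) (hu : Monotone u) (c d : ℕ → ℝ)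
    (n : ℕ) {b l : ℝ} (hl : 0 ≤ l) (hd : ∀ k ≤ n, 0 < d k) (hb0 : 0 < b)
    (hb : ∀ k ≤ n, b ≤ l / d k - l ^ 2 * stepVariance u c k / 2) :
    ∫⁻ ω, ENNReal.ofReal (Real.exp ((Finset.range (n + 1)).sup' Finset.nonempty_range_add_one
      fun k => d k * stepIntegral W u c k ω)) ∂P ≤
      ENNReal.ofReal (1 + Real.exp (1 / (2 * b)) * (√(Real.pi / (b / 2)) / 2)) := by
  refine lintegral_exp_le_of_gaussian_tail (measurable_sup_stepIntegral hW u c d n).aemeasurable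
    (fun ω => ?_) hb0 fun a ha => measure_le_sup_stepIntegral hW u hu c d n hl hd hb ha
  -- The maximum is nonnegative because the empty sum at `k = 0` vanishes.
  refine (Finset.le_sup'_iff _).2 ⟨0, by simp, ?_⟩
  simp [stepIntegral]

/-! ### Grids that stay below the singular time 1. -/

/-- The partition of `[t, 1]` into `n + 1` intervals of equal length. -/
noncomputable def grid (t : ℝ≥0) (n i : ℕ) : ℝ≥0 := t + (i / (n + 1)) * (1 - t)

theorem coe_grid {t : ℝ≥0} (ht : t ≤ 1) (n i : ℕ) :
    (grid t n i : ℝ) = t + (i / (n + 1)) * (1 - t) := by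
  simp [grid, NNReal.coe_sub ht]

theorem grid_zero (t : ℝ≥0) (n : ℕ) : grid t n 0 = t := by simp [grid]

theorem monotone_grid (t : ℝ≥0) (n : ℕ) : Monotone (grid t n) := fun i j hij => by
  unfold grid
  gcongr

theorem grid_lt_one {t : ℝ≥0} (ht : t < 1) {n k : ℕ} (hk : k ≤ n) : grid t n k < 1 := by
  have ht' : (t : ℝ) < 1 := by exact_mod_cast ht
  have hk' : (k : ℝ) / (n + 1) < 1 := by
    rw [div_lt_one (by positivity)]
    exact_mod_cast Nat.lt_succ_of_le hk
  have : (grid t n k : ℝ) < 1 := by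
    rw [coe_grid ht.le]
    nlinarith
  exact_mod_cast this

theorem coe_grid_succ_sub {t : ℝ≥0} (ht : t ≤ 1) (n i : ℕ) :
    (grid t n (i + 1) : ℝ) - grid t n i = (1 - t) / (n + 1) := by
  rw [coe_grid ht, coe_grid ht]
  push_cast
  ring

/-- The index of a grid point close to `s`. -/
noncomputable def gridIndex (t s : ℝ≥0) (n : ℕ) : ℕ := ⌊((s : ℝ) - t) / (1 - t) * n⌋₊

theorem gridIndex_le {t s : ℝ≥0} (ht : t < 1) (hs : s ≤ 1) (n : ℕ) : gridIndex t s n ≤ n := by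
  have ht' : (t : ℝ) < 1 := by exact_mod_cast ht
  have hs' : (s : ℝ) ≤ 1 := by exact_mod_cast hs
  refine Nat.floor_le_of_le (mul_le_of_le_one_left n.cast_nonneg ?_)
  rw [div_le_one (by linarith)]
  linarith

theorem tendsto_grid_gridIndex {t s : ℝ≥0} (ht : t < 1) (hts : t ≤ s) :
    Tendsto (fun n => grid t n (gridIndex t s n)) atTop (𝓝 s) := by
  have ht' : (t : ℝ) < 1 := by exact_mod_cast ht
  have hts' : (t : ℝ) ≤ s := by exact_mod_cast hts
  rw [← NNReal.tendsto_coe]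
  simp only [coe_grid ht.le, gridIndex]
  have h1 := (tendsto_nat_floor_mul_div_atTop (R := ℝ) (a := ((s : ℝ) - t) / (1 - t))
    (div_nonneg (by linarith) (by linarith))).comp tendsto_natCast_atTop_atTop
  have h2 := ((h1.mul (tendsto_natCast_div_add_atTop (1 : ℝ))).mul_const (1 - (t : ℝ))).const_add
    (t : ℝ)
  have e : (t : ℝ) + (s - t) / (1 - t) * 1 * (1 - t) = s := by
    have : (1 : ℝ) - t ≠ 0 := by linarith
    field_simp
    ring
  rw [e] at h2
  refine h2.congr' ((eventually_ne_atTop 0).mono fun n hn => ?_)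
  have : (n : ℝ) ≠ 0 := by exact_mod_cast hn
  simp only [Function.comp_apply]
  field_simp

/-! ### Pathwise approximation of the bridge by step integrals. -/

theorem deriv_inv_one_sub (u : ℝ) : deriv (fun u : ℝ => (1 - u)⁻¹) u = ((1 - u) ^ 2)⁻¹ := by
  have h := deriv_comp_const_sub (fun y : ℝ => y⁻¹) 1 u
  rw [h, deriv_inv]
  simp

theorem continuousOn_deriv_mul_path {W : ℝ≥0 → Ω → ℝ} {ω : Ω} (hc : Continuous (W · ω)) :
    ContinuousOn (fun u : ℝ => deriv (fun u : ℝ => (1 - u)⁻¹) u * W u.toNNReal ω) (Set.Iio 1) := by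
  simp only [deriv_inv_one_sub]
  refine ContinuousOn.mul (ContinuousOn.inv₀ (by fun_prop) fun u hu => ?_)
    (hc.comp continuous_real_toNNReal).continuousOn
  exact pow_ne_zero _ (sub_ne_zero.2 (ne_of_gt hu))

theorem intervalIntegrable_deriv_mul_path {W : ℝ≥0 → Ω → ℝ} {ω : Ω} (hc : Continuous (W · ω))
    {a b : ℝ} (ha : a < 1) (hb : b < 1) :
    IntervalIntegrable (fun u : ℝ => deriv (fun u : ℝ => (1 - u)⁻¹) u * W u.toNNReal ω)
      volume a b :=
  ((continuousOn_deriv_mul_path hc).mono fun _ hu =>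
    hu.2.trans_lt (max_lt ha hb)).intervalIntegrable

theorem continuousAt_wienerIntegral {W : ℝ≥0 → Ω → ℝ} {ω : Ω} (hc : Continuous (W · ω))
    {t s : ℝ≥0} (ht : t < 1) (hs : s < 1) :
    ContinuousAt (fun s => wienerIntegral W (fun u => (1 - u)⁻¹) t s ω) s := by
  have ht' : (t : ℝ) < 1 := by exact_mod_cast ht
  have hs' : (s : ℝ) < 1 := by exact_mod_cast hs
  have h0 : (1 : ℝ) - s ≠ 0 := by linarith
  have hgc := continuousOn_deriv_mul_path hc
  have h1 := (intervalIntegral.integral_hasDerivAt_right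
    (intervalIntegrable_deriv_mul_path hc ht' hs')
    (hgc.stronglyMeasurableAtFilter isOpen_Iio _ hs')
    (hgc.continuousAt (isOpen_Iio.mem_nhds hs'))).continuousAt
  have h2 : ContinuousAt (fun r : ℝ≥0 => ∫ u in (t : ℝ)..r,
      deriv (fun u : ℝ => (1 - u)⁻¹) u * W u.toNNReal ω) s :=
    ContinuousAt.comp (f := fun r : ℝ≥0 => (r : ℝ)) h1 NNReal.continuous_coe.continuousAt
  unfold wienerIntegral
  refine ContinuousAt.sub (ContinuousAt.sub (ContinuousAt.mul ?_ hc.continuousAt)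
    continuousAt_const) h2
  exact ContinuousAt.inv₀ (by fun_prop) h0

/-- With `f u = 1/(1-u)`, integration by parts on `[p,q]` leaves the error `-∫ f' (W_u - W_q) du`,
since `∫ f' = f q - f p`. As `f' ≥ 0`, the oscillation of the path controls it. -/
theorem abs_wienerIntegral_sub_step_le {W : ℝ≥0 → Ω → ℝ} {ω : Ω} (hc : Continuous (W · ω))
    {t p q : ℝ≥0} (ht : t < 1) (hpq : p ≤ q) (hq : q < 1) {ε : ℝ}
    (hε : ∀ u, p ≤ u → u ≤ q → |W u ω - W q ω| ≤ ε) :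
    |wienerIntegral W (fun u => (1 - u)⁻¹) t q ω - wienerIntegral W (fun u => (1 - u)⁻¹) t p ω -
      (1 - (p : ℝ))⁻¹ * (W q ω - W p ω)| ≤ ε * ((1 - (q : ℝ))⁻¹ - (1 - (p : ℝ))⁻¹) := by
  have ht' : (t : ℝ) < 1 := by exact_mod_cast ht
  have hq' : (q : ℝ) < 1 := by exact_mod_cast hq
  have hpq' : (p : ℝ) ≤ q := by exact_mod_cast hpq
  have hp' : (p : ℝ) < 1 := hpq'.trans_lt hq'
  have hsub : Set.uIcc (p : ℝ) q ⊆ Set.Iio 1 := fun u hu => hu.2.trans_lt (max_lt hp' hq')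
  have hder : ∀ u ∈ Set.uIcc (p : ℝ) q,
      HasDerivAt (fun u : ℝ => (1 - u)⁻¹) (((1 - u) ^ 2)⁻¹) u := fun u hu => by
    have h0 : (1 : ℝ) - u ≠ 0 := sub_ne_zero.2 (ne_of_gt (hsub hu))
    refine (((hasDerivAt_id u).const_sub 1).inv h0).congr_deriv ?_
    simp
  have hint : IntervalIntegrable (fun u : ℝ => ((1 - u) ^ 2)⁻¹) volume p q := by
    refine ContinuousOn.intervalIntegrable (ContinuousOn.inv₀ (by fun_prop) fun u hu => ?_)
    exact pow_ne_zero _ (sub_ne_zero.2 (ne_of_gt (hsub hu)))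
  have hI := intervalIntegral.integral_eq_sub_of_hasDerivAt hder hint
  have hadd := intervalIntegral.integral_add_adjacent_intervals
    (intervalIntegrable_deriv_mul_path hc ht' hp') (intervalIntegrable_deriv_mul_path hc hp' hq')
  have key : wienerIntegral W (fun u => (1 - u)⁻¹) t q ω -
      wienerIntegral W (fun u => (1 - u)⁻¹) t p ω - (1 - (p : ℝ))⁻¹ * (W q ω - W p ω) =
      -∫ u in (p : ℝ)..q, ((1 - u) ^ 2)⁻¹ * (W u.toNNReal ω - W q ω) := by
    have h2 := intervalIntegrable_deriv_mul_path hc hp' hq'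
    simp only [wienerIntegral]
    simp only [deriv_inv_one_sub] at hadd h2 ⊢
    simp only [mul_sub]
    rw [intervalIntegral.integral_sub h2 (hint.mul_const _), intervalIntegral.integral_mul_const,
      hI, ← hadd]
    ring
  rw [key, abs_neg, ← Real.norm_eq_abs, ← hI, ← intervalIntegral.integral_const_mul]
  refine intervalIntegral.norm_integral_le_of_norm_le hpq' (ae_of_all _ fun u hu => ?_)
    (hint.const_mul _)
  have hu0 : 0 ≤ u := p.2.trans hu.1.le
  have h1 := hε u.toNNReal (NNReal.coe_le_coe.1 (by rw [Real.coe_toNNReal _ hu0]; exact hu.1.le))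
    (by rw [Real.toNNReal_le_iff_le_coe]; exact hu.2)
  rw [norm_mul, Real.norm_eq_abs, Real.norm_eq_abs, mul_comm]
  have h0 : 0 ≤ ((1 - u) ^ 2)⁻¹ := by positivity
  rw [abs_of_nonneg h0]
  exact mul_le_mul_of_nonneg_right h1 h0

/-- The one-step errors telescope. The total blows up only like `1/(1-u)` at the grid point `u`, so
the bridge's prefactor `1-u` reduces it to at most `ε`. -/
theorem abs_stepIntegral_sub_wienerIntegral_le {W : ℝ≥0 → Ω → ℝ} {ω : Ω}
    (hc : Continuous (W · ω)) {t : ℝ≥0} (ht : t < 1) {n : ℕ} {ε : ℝ}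
    (hε : ∀ p q : ℝ≥0, p ≤ 1 → q ≤ 1 → dist p q ≤ 1 / ((n : ℝ) + 1) → |W p ω - W q ω| ≤ ε) {k : ℕ}
    (hk : k ≤ n) :
    |wienerIntegral W (fun u => (1 - u)⁻¹) t (grid t n k) ω -
      stepIntegral W (grid t n) (fun i => (1 - (grid t n i : ℝ))⁻¹) k ω| ≤
      ε * ((1 - (grid t n k : ℝ))⁻¹ - (1 - (t : ℝ))⁻¹) := by
  induction k with
  | zero => simp [grid_zero, stepIntegral, wienerIntegral]
  | succ k ih =>
    have h1 := ih (k.le_succ.trans hk)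
    have h2 := abs_wienerIntegral_sub_step_le hc ht (monotone_grid t n k.le_succ)
      (grid_lt_one ht hk) (ε := ε) fun u hu1 hu2 => by
        have hg := (grid_lt_one ht hk).le
        refine hε u _ (hu2.trans hg) hg ?_
        have e := coe_grid_succ_sub ht.le n k
        have hu1' : (grid t n k : ℝ) ≤ u := by exact_mod_cast hu1
        have hu2' : (u : ℝ) ≤ grid t n (k + 1) := by exact_mod_cast hu2
        have ht0 : (0 : ℝ) ≤ t := t.2
        rw [dist_comm, NNReal.dist_eq, abs_of_nonneg (by linarith)]
        have : (1 - (t : ℝ)) / (n + 1) ≤ 1 / (n + 1) := by gcongr; linarith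
        linarith
    simp only [stepIntegral, Finset.sum_range_succ] at h1 ⊢
    have h3 := abs_add_le _ _ |>.trans (add_le_add h1 h2)
    refine le_trans (le_of_eq ?_) (h3.trans (le_of_eq ?_))
    · congr 1
      simp only [Nat.succ_eq_add_one]
      ring
    · simp only [Nat.succ_eq_add_one]
      ring

theorem tendsto_stepIntegral_bridge {W : ℝ≥0 → Ω → ℝ} {ω : Ω}
    (hc : Continuous (W · ω)) {t s : ℝ≥0} (hts : t ≤ s) (hs : s < 1) :
    Tendsto (fun n => (1 - (grid t n (gridIndex t s n) : ℝ)) *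
      stepIntegral W (grid t n) (fun i => (1 - (grid t n i : ℝ))⁻¹) (gridIndex t s n) ω) atTop
      (𝓝 (brownianBridge W t 0 s ω)) := by
  have ht := hts.trans_lt hs
  have hg := tendsto_grid_gridIndex ht hts
  have h1 : Tendsto (fun n => (1 - (grid t n (gridIndex t s n) : ℝ)) *
      wienerIntegral W (fun u => (1 - u)⁻¹) t (grid t n (gridIndex t s n)) ω) atTop
      (𝓝 (brownianBridge W t 0 s ω)) := by
    simp only [brownianBridge, if_pos ht, zero_div, zero_add]
    exact ((NNReal.tendsto_coe.2 hg).const_sub 1).mul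
      ((continuousAt_wienerIntegral hc ht hs).tendsto.comp hg)
  refine h1.congr_dist ?_
  rw [Metric.tendsto_atTop]
  intro δ hδ
  -- Uniform continuity of the path on `[0,1]` supplies the oscillation bound once the mesh, at most
  -- `1/(n+1)`, is small.
  have huc := (isCompact_Icc (a := (0 : ℝ≥0)) (b := 1)).uniformContinuousOn_of_continuous
    hc.continuousOn
  obtain ⟨η, hη, huc⟩ := Metric.uniformContinuousOn_iff.1 huc (δ / 2) (half_pos hδ)
  obtain ⟨N, hN⟩ := exists_nat_one_div_lt hη
  refine ⟨N, fun n hn => ?_⟩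
  have hle := gridIndex_le ht hs.le n
  have hlt : (grid t n (gridIndex t s n) : ℝ) < 1 := by exact_mod_cast grid_lt_one ht hle
  have ht' : (t : ℝ) < 1 := by exact_mod_cast ht
  have h2 := abs_stepIntegral_sub_wienerIntegral_le hc ht (n := n) (ε := δ / 2)
    (fun p q hp hq hpq => (huc p ⟨zero_le, hp⟩ q ⟨zero_le, hq⟩ (hpq.trans_lt
      ((Nat.one_div_le_one_div hn).trans_lt hN))).le) hle
  rw [Real.dist_0_eq_abs, abs_of_nonneg dist_nonneg, Real.dist_eq, ← mul_sub, abs_mul,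
    abs_of_pos (sub_pos.2 hlt)]
  have h3 := mul_le_mul_of_nonneg_left h2 (sub_pos.2 hlt).le
  refine h3.trans_lt ?_
  have h4 : 0 ≤ (1 - (t : ℝ))⁻¹ := by
    have := sub_pos.2 ht'
    positivity
  have h5 : (1 - (grid t n (gridIndex t s n) : ℝ)) * (1 - (grid t n (gridIndex t s n) : ℝ))⁻¹ = 1 :=
    mul_inv_cancel₀ (sub_pos.2 hlt).ne'
  have h6 := mul_nonneg (mul_nonneg (half_pos hδ).le (sub_pos.2 hlt).le) h4
  nlinarith

theorem tendsto_stepIntegral_const {W : ℝ≥0 → Ω → ℝ} {ω : Ω} (hc : Continuous (W · ω))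
    (h0 : W 0 ω = 0) (a : ℝ) (s : ℝ≥0) :
    Tendsto (fun n => stepIntegral W (grid 0 n) (fun _ => a) (gridIndex 0 s n) ω) atTop
      (𝓝 (a * W s ω)) := by
  have e : ∀ n k, stepIntegral W (grid 0 n) (fun _ => a) k ω = a * W (grid 0 n k) ω := fun n k => by
    rw [stepIntegral, ← Finset.mul_sum, Finset.sum_range_sub (fun i => W (grid 0 n i) ω), grid_zero,
      h0, sub_zero]
  simp only [e]
  exact ((hc.tendsto s).comp (tendsto_grid_gridIndex one_pos zero_le)).const_mul a

/-- A left Riemann sum of the increasing function `1/(1-u)²` lies below its integral; each term is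
compared with an increment of `1/(1-u)`. -/
theorem stepVariance_bridge_le {t : ℝ≥0} (ht : t < 1) {n k : ℕ} (hk : k ≤ n) :
    stepVariance (grid t n) (fun i => (1 - (grid t n i : ℝ))⁻¹) k ≤
      (1 - (grid t n k : ℝ))⁻¹ - (1 - (t : ℝ))⁻¹ := by
  induction k with
  | zero => simp [grid_zero, stepVariance]
  | succ k ih =>
    have h1 := ih (k.le_succ.trans hk)
    have hlt : (grid t n (k + 1) : ℝ) < 1 := by exact_mod_cast grid_lt_one ht hk
    have hle : (grid t n k : ℝ) ≤ grid t n (k + 1) := by exact_mod_cast monotone_grid t n k.le_succ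
    simp only [stepVariance, Finset.sum_range_succ] at h1 ⊢
    have ha : 0 < 1 - (grid t n k : ℝ) := by linarith
    have hb : 0 < 1 - (grid t n (k + 1) : ℝ) := by linarith
    set x := (grid t n k : ℝ)
    set y := (grid t n (k + 1) : ℝ)
    have h2 : (1 - x)⁻¹ ^ 2 * (y - x) ≤ (1 - x)⁻¹ * (1 - y)⁻¹ * (y - x) := by
      rw [sq]
      have := inv_anti₀ hb (by linarith : 1 - y ≤ 1 - x)
      gcongr
    have h3 : (1 - x)⁻¹ * (1 - y)⁻¹ * (y - x) = (1 - y)⁻¹ - (1 - x)⁻¹ := by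
      field_simp
      ring
    linarith

theorem stepVariance_const (n k : ℕ) (a : ℝ) :
    stepVariance (grid 0 n) (fun _ => a) k = a ^ 2 * grid 0 n k := by
  rw [stepVariance, ← Finset.mul_sum, Finset.sum_range_sub (fun i => (grid 0 n i : ℝ)), grid_zero]
  simp

/-! ### Passage to the limit by Fatou and the uniform bridge bound. -/

/-- The approximating index `j` may vary with the path while the maximum on the right does not
involve it; this is how random times are handled. -/
theorem ofReal_exp_le_liminf {Y : ℕ → ℕ → ℝ} {j : ℕ → ℕ} {y : ℝ} (hj : ∀ n, j n ≤ n)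
    (h : Tendsto (fun n => Y n (j n)) atTop (𝓝 y)) :
    ENNReal.ofReal (Real.exp y) ≤ liminf (fun n => ENNReal.ofReal (Real.exp
      ((Finset.range (n + 1)).sup' Finset.nonempty_range_add_one (Y n)))) atTop := by
  have h1 : Tendsto (fun n => ENNReal.ofReal (Real.exp (Y n (j n)))) atTop
      (𝓝 (ENNReal.ofReal (Real.exp y))) :=
    (ENNReal.continuous_ofReal.tendsto _).comp ((Real.continuous_exp.tendsto _).comp h)
  rw [← h1.liminf_eq]
  refine liminf_le_liminf (Eventually.of_forall fun n => ENNReal.ofReal_le_ofReal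
    (Real.exp_le_exp.2 ?_))
  exact Finset.le_sup' (Y n) (Finset.mem_range.2 (Nat.lt_succ_of_le (hj n)))

theorem lintegral_le_of_ae_le_liminf {P : Measure Ω} {f : Ω → ℝ≥0∞} {g : ℕ → Ω → ℝ≥0∞} {C : ℝ≥0∞}
    (hg : ∀ n, Measurable (g n)) (hC : ∀ n, ∫⁻ ω, g n ω ∂P ≤ C)
    (h : ∀ᵐ ω ∂P, f ω ≤ liminf (fun n => g n ω) atTop) : ∫⁻ ω, f ω ∂P ≤ C := by
  refine (lintegral_mono_ae h).trans ((lintegral_liminf_le hg).trans ?_)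
  refine (liminf_le_liminf (Eventually.of_forall hC)).trans ?_
  simp

/-- Uniform bound for the exponential moment of the bridge started at `0`. -/
theorem lintegral_exp_bridge_zero_le {P : Measure Ω} [IsProbabilityMeasure P] [P.IsComplete]
    {W : ℝ≥0 → Ω → ℝ} (hW : IsBrownianReal W P) {t : ℝ≥0} (σ : Ω → ℝ≥0) (htσ : ∀ ω, t ≤ σ ω)
    (hσ : ∀ ω, σ ω ≤ 1) :
    ∫⁻ ω, ENNReal.ofReal (Real.exp (brownianBridge W t 0 (σ ω) ω)) ∂P ≤
      ENNReal.ofReal (1 + Real.exp (1 / (2 * 2)) * (√(Real.pi / (2 / 2)) / 2)) := by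
  by_cases ht : t < 1
  swap
  · simp only [brownianBridge, if_neg ht, Real.exp_zero, lintegral_const, measure_univ, mul_one]
    exact ENNReal.ofReal_le_ofReal (le_add_of_nonneg_right (by positivity))
  have ht' : (t : ℝ) < 1 := by exact_mod_cast ht
  refine lintegral_le_of_ae_le_liminf (g := fun n ω => ENNReal.ofReal (Real.exp
    ((Finset.range (n + 1)).sup' Finset.nonempty_range_add_one fun k => (1 - (grid t n k : ℝ)) *
      stepIntegral W (grid t n) (fun i => (1 - (grid t n i : ℝ))⁻¹) k ω))) (fun n => ?_)
    (fun n => ?_) ?_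
  · exact ENNReal.measurable_ofReal.comp (Real.measurable_exp.comp
      (measurable_sup_stepIntegral hW.toIsPreBrownianReal _ _ _ n))
  · have hlt : ∀ k ≤ n, 0 < 1 - (grid t n k : ℝ) := fun k hk => by
      have : (grid t n k : ℝ) < 1 := by exact_mod_cast grid_lt_one ht hk
      linarith
    -- At a grid point `u`, `l = 2` makes `2/(1-u)` cancel against twice the variance bound `1/(1-u)
    -- - 1/(1-t)`. What remains is `2/(1-t) ≥ 2`, so `b = 2` serves for all `t`.
    refine lintegral_exp_sup_stepIntegral_le hW.toIsPreBrownianReal _ (monotone_grid t n) _ _ n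
      (l := 2) zero_le_two hlt two_pos fun k hk => ?_
    have h1 := stepVariance_bridge_le ht hk
    have h2 : 1 ≤ (1 - (t : ℝ))⁻¹ := by
      rw [one_le_inv₀ (by linarith)]
      linarith [t.2]
    rw [div_eq_mul_inv]
    linarith
  · filter_upwards [hW.cont] with ω hc
    rcases (hσ ω).lt_or_eq with h1 | h1
    · exact ofReal_exp_le_liminf (fun n => gridIndex_le ht h1.le n)
        (Y := fun n k => (1 - (grid t n k : ℝ)) *
          stepIntegral W (grid t n) (fun i => (1 - (grid t n i : ℝ))⁻¹) k ω)
        (tendsto_stepIntegral_bridge hc (htσ ω) h1)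
    -- The grid points `k ≤ n` never reach time 1, but the bridge is 0 there, which is the value at
    -- index 0.
    · rw [h1, brownianBridge_one W ht]
      exact ofReal_exp_le_liminf (j := fun _ => 0) (fun n => zero_le)
        (Y := fun n k => (1 - (grid t n k : ℝ)) *
          stepIntegral W (grid t n) (fun i => (1 - (grid t n i : ℝ))⁻¹) k ω)
        (by simp [stepIntegral])

/-! ### Finiteness of `c₁`. -/

theorem exists_supAbs_eq {W : ℝ≥0 → Ω → ℝ} {ω : Ω} (hc : Continuous (W · ω)) :
    (∃ s ≤ 1, supAbs W ω = |W s ω|) ∧ ∀ s ≤ 1, |W s ω| ≤ supAbs W ω := by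
  obtain ⟨s, hs, hmax⟩ := (isCompact_Icc (a := (0 : ℝ≥0)) (b := 1)).exists_isMaxOn
    ⟨0, by simp⟩ hc.abs.continuousOn
  have hle : ∀ r : Set.Icc (0 : ℝ≥0) 1, |W r ω| ≤ |W s ω| := fun r => hmax r.2
  have hbdd : BddAbove (Set.range fun r : Set.Icc (0 : ℝ≥0) 1 => |W r ω|) :=
    ⟨_, Set.forall_mem_range.2 hle⟩
  have : Nonempty (Set.Icc (0 : ℝ≥0) 1) := ⟨⟨s, hs⟩⟩
  exact ⟨⟨s, hs.2, le_antisymm (ciSup_le hle) (le_ciSup hbdd ⟨s, hs⟩)⟩,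
    fun r hr => le_ciSup hbdd ⟨r, zero_le, hr⟩⟩

theorem aemeasurable_supAbs {P : Measure Ω} [P.IsComplete] {W : ℝ≥0 → Ω → ℝ}
    (hW : IsBrownianReal W P) : AEMeasurable (supAbs W) P := by
  obtain ⟨S, hS, hd⟩ := TopologicalSpace.exists_countable_dense (Set.Icc (0 : ℝ≥0) 1)
  have := hS.to_subtype
  refine ⟨fun ω => ⨆ s : S, |W s ω|, Measurable.iSup fun s =>
    (measurable_of_isPreBrownianReal hW.toIsPreBrownianReal _).abs, ?_⟩
  filter_upwards [hW.cont] with ω hc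
  exact (hd.ciSup' (hc.comp continuous_subtype_val).abs).symm

theorem lintegral_exp_supAbs_lt_top {P : Measure Ω} [IsProbabilityMeasure P] [P.IsComplete]
    {W : ℝ≥0 → Ω → ℝ} (hW : IsBrownianReal W P) :
    ∫⁻ ω, ENNReal.ofReal (Real.exp (supAbs W ω)) ∂P < ∞ := by
  set g : ℝ → ℕ → Ω → ℝ≥0∞ := fun a n ω => ENNReal.ofReal (Real.exp
    ((Finset.range (n + 1)).sup' Finset.nonempty_range_add_one fun k => 1 *
      stepIntegral W (grid 0 n) (fun _ => a) k ω)) with hg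
  have hgm : ∀ a n, Measurable (g a n) := fun a n =>
    ENNReal.measurable_ofReal.comp (Real.measurable_exp.comp
      (measurable_sup_stepIntegral hW.toIsPreBrownianReal (grid 0 n) _ (fun _ => 1) n))
  have hbound : ∀ a : ℝ, a ^ 2 = 1 → ∫⁻ ω, liminf (fun n => g a n ω) atTop ∂P ≤
      ENNReal.ofReal (1 + Real.exp (1 / (2 * (1 / 2))) * (√(Real.pi / (1 / 2 / 2)) / 2)) := by
    intro a ha
    refine lintegral_le_of_ae_le_liminf (hgm a) (fun n => ?_) (ae_of_all _ fun ω => le_rfl)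
    -- Here the variance is at most 1, so `l = 1` gives `1 - 1/2 = 1/2` for `b`.
    refine lintegral_exp_sup_stepIntegral_le hW.toIsPreBrownianReal (grid 0 n) (monotone_grid 0 n)
      (fun _ => a) (fun _ => 1) n (l := 1) zero_le_one (fun _ _ => one_pos) (by norm_num)
      fun k hk => ?_
    have : (grid 0 n k : ℝ) < 1 := by exact_mod_cast grid_lt_one one_pos hk
    rw [stepVariance_const, ha]
    linarith
  have hle : ∀ᵐ ω ∂P, ENNReal.ofReal (Real.exp (supAbs W ω)) ≤
      liminf (fun n => g 1 n ω) atTop + liminf (fun n => g (-1) n ω) atTop := by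
    filter_upwards [hW.cont, hW.eval_zero_ae_eq_zero] with ω hc h0
    -- The supremum is attained at some `s`, so its exponential is bounded by the limit for `W` or
    -- the one for `-W`, according to the sign of `W s`.
    obtain ⟨s, hs, he⟩ := (exists_supAbs_eq hc).1
    have hlim : ∀ a : ℝ, ENNReal.ofReal (Real.exp (a * W s ω)) ≤
        liminf (fun n => g a n ω) atTop := fun a =>
      ofReal_exp_le_liminf (fun n => gridIndex_le one_pos hs n)
        (Y := fun n k => 1 * stepIntegral W (grid 0 n) (fun _ => a) k ω)
        (by simpa only [one_mul] using tendsto_stepIntegral_const hc h0 a s)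
    rw [he]
    rcases abs_cases (W s ω) with ⟨h, -⟩ | ⟨h, -⟩ <;> rw [h]
    · exact le_add_right (by simpa using hlim 1)
    · exact le_add_left (by simpa using hlim (-1))
  refine (lintegral_mono_ae hle).trans_lt ?_
  rw [lintegral_add_left (Measurable.liminf (hgm 1))]
  exact ENNReal.add_lt_top.2 ⟨(hbound 1 (by norm_num)).trans_lt ENNReal.ofReal_lt_top,
    (hbound (-1) (by norm_num)).trans_lt ENNReal.ofReal_lt_top⟩

theorem integrable_exp_supAbs {P : Measure Ω} [IsProbabilityMeasure P] [P.IsComplete]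
    {W : ℝ≥0 → Ω → ℝ} (hW : IsBrownianReal W P) :
    Integrable (fun ω => Real.exp (supAbs W ω)) P := by
  refine ⟨(Real.measurable_exp.comp_aemeasurable (aemeasurable_supAbs hW)).aestronglyMeasurable, ?_⟩
  rw [hasFiniteIntegral_iff_ofReal (ae_of_all _ fun ω => (Real.exp_pos _).le)]
  exact lintegral_exp_supAbs_lt_top hW

/-! ### Numerical comparison of the bridge bound with `c₁`. -/

theorem integral_abs_gaussianReal :
    ∫ x, |x| ∂gaussianReal 0 1 = 2 / √(2 * Real.pi) := by
  have h1 : ∫ x in Set.Ioi (0 : ℝ), x * Real.exp (-(1 / 2) * x ^ 2) = 1 := by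
    have h := integral_rpow_mul_exp_neg_mul_rpow (p := 2) (q := 1) (b := 1 / 2) two_pos
      (by norm_num) (by norm_num)
    norm_num at h
    norm_num
    exact h
  rw [integral_gaussianReal_eq_integral_smul one_ne_zero]
  have h2 : ∀ x : ℝ, gaussianPDFReal 0 1 x • |x| =
      (fun y => (√(2 * Real.pi))⁻¹ * (y * Real.exp (-(1 / 2) * y ^ 2))) |x| := fun x => by
    simp only [gaussianPDFReal, smul_eq_mul, NNReal.coe_one, mul_one, sub_zero, sq_abs]
    ring_nf
  simp_rw [h2]
  rw [integral_comp_abs (f := fun y => (√(2 * Real.pi))⁻¹ * (y * Real.exp (-(1 / 2) * y ^ 2))),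
    integral_const_mul, h1]
  ring

/-- Since `S_1 ≥ |W_1|`, the quadratic Taylor bound gives `c₁ ≥ 1 + √(2/π) + 1/2 ≈ 2.30`, while the
bridge bound is about `2.14`. The rounded constants below still leave `2.154 ≤ 2.25`. -/
theorem le_c₁ {P : Measure Ω} [IsProbabilityMeasure P] [P.IsComplete]
    {W : ℝ≥0 → Ω → ℝ} (hW : IsBrownianReal W P) :
    1 + Real.exp (1 / (2 * 2)) * (√(Real.pi / (2 / 2)) / 2) ≤ c₁ W P := by
  have hlaw := hW.hasLaw_eval 1
  have hL2 : MemLp (W 1) 2 P := (hW.isGaussianProcess.hasGaussianLaw_eval 1).memLp_two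
  have hi1 : Integrable (W 1) P := hW.integrable_eval 1
  have hsq : ∫ ω, W 1 ω ^ 2 ∂P = 1 := by
    rw [← variance_of_integral_eq_zero (hW.aemeasurable 1) (hW.integral_eval 1), hlaw.variance_eq,
      variance_id_gaussianReal]
    simp
  have habs : ∫ ω, |W 1 ω| ∂P = 2 / √(2 * Real.pi) := by
    rw [← integral_abs_gaussianReal]
    exact hlaw.integral_comp (f := fun x => |x|) (by fun_prop)
  have hint : Integrable (fun ω => 1 + |W 1 ω| + W 1 ω ^ 2 / 2) P :=
    ((integrable_const 1).add hi1.abs).add (hL2.integrable_sq.div_const 2)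
  have hle : ∫ ω, (1 + |W 1 ω| + W 1 ω ^ 2 / 2) ∂P ≤ c₁ W P := by
    refine integral_mono_ae hint (integrable_exp_supAbs hW) ?_
    filter_upwards [hW.cont] with ω hc
    have h1 := Real.quadratic_le_exp_of_nonneg (abs_nonneg (W 1 ω))
    rw [sq_abs] at h1
    exact h1.trans (Real.exp_le_exp.2 ((exists_supAbs_eq hc).2 1 le_rfl))
  have heq : ∫ ω, (1 + |W 1 ω| + W 1 ω ^ 2 / 2) ∂P = 1 + 2 / √(2 * Real.pi) + 1 / 2 := by
    have hi2 : Integrable (fun ω => 1 + |W 1 ω|) P := (integrable_const 1).add hi1.abs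
    rw [integral_add hi2 (hL2.integrable_sq.div_const 2),
      integral_add (integrable_const 1) hi1.abs, integral_div, hsq, habs]
    simp
  rw [heq] at hle
  refine le_trans ?_ hle
  have hpi := Real.pi_lt_d2
  have he : Real.exp (1 / (2 * 2)) ≤ 1.3 := by
    have h4 : Real.exp (1 / (2 * 2)) ^ 4 = Real.exp 1 := by
      rw [← Real.exp_nat_mul]
      norm_num
    refine le_of_pow_le_pow_left₀ (n := 4) (by norm_num) (by norm_num) ?_
    rw [h4]
    exact Real.exp_one_lt_d9.le.trans (by norm_num)
  have hs1 : √(Real.pi / (2 / 2)) ≤ 1.775 := by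
    rw [Real.sqrt_le_left (by norm_num)]
    norm_num at hpi ⊢
    linarith
  have hs2 : √(2 * Real.pi) ≤ 2.52 := by
    rw [Real.sqrt_le_left (by norm_num)]
    norm_num at hpi ⊢
    linarith
  have h3 : 0.75 ≤ 2 / √(2 * Real.pi) := by
    rw [le_div_iff₀ (Real.sqrt_pos.2 (by positivity))]
    linarith
  have h5 : Real.exp (1 / (2 * 2)) * (√(Real.pi / (2 / 2)) / 2) ≤ 1.3 * (1.775 / 2) := by
    gcongr
  linarith

/-! ### Affine dependence on the starting point. -/

/-- The weight of the starting point `x` in the value of the bridge at time `s`. -/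
noncomputable def bridgeSlope (t s : ℝ≥0) : ℝ := if t < 1 then (1 - (s : ℝ)) / (1 - t) else 1

theorem brownianBridge_eq (W : ℝ≥0 → Ω → ℝ) (t s : ℝ≥0) (x : ℝ) (ω : Ω) :
    brownianBridge W t x s ω = bridgeSlope t s * x + brownianBridge W t 0 s ω := by
  unfold brownianBridge bridgeSlope
  split_ifs <;> ring

theorem bridgeSlope_nonneg {t s : ℝ≥0} (hs : s ≤ 1) : 0 ≤ bridgeSlope t s := by
  have hs' : (s : ℝ) ≤ 1 := by exact_mod_cast hs
  unfold bridgeSlope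
  split_ifs with ht
  · have ht' : (t : ℝ) < 1 := by exact_mod_cast ht
    exact div_nonneg (by linarith) (by linarith)
  · exact zero_le_one

theorem bridgeSlope_le_one {t s : ℝ≥0} (hts : t ≤ s) : bridgeSlope t s ≤ 1 := by
  have hts' : (t : ℝ) ≤ s := by exact_mod_cast hts
  unfold bridgeSlope
  split_ifs with ht
  · have ht' : (t : ℝ) < 1 := by exact_mod_cast ht
    rw [div_le_one (by linarith)]
    linarith
  · exact le_rfl

/-! ### Measurability of the bridge at a random time. -/

theorem measurable_brownianBridge_comp {W : ℝ≥0 → Ω → ℝ} (hW : Measurable (Function.uncurry W))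
    {t : ℝ≥0} (x : ℝ) {σ : Ω → ℝ≥0} (hσ : Measurable σ) (htσ : ∀ ω, t ≤ σ ω) :
    Measurable fun ω => brownianBridge W t x (σ ω) ω := by
  unfold brownianBridge
  split_ifs with ht
  swap
  · exact measurable_const
  have hWσ : Measurable fun ω => W (σ ω) ω := hW.comp (hσ.prodMk measurable_id)
  have hWt : Measurable fun ω => W t ω := hW.comp (measurable_const.prodMk measurable_id)
  have hint : Measurable fun ω => ∫ u in (t : ℝ)..(σ ω : ℝ),
      deriv (fun u : ℝ => (1 - u)⁻¹) u * W u.toNNReal ω := by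
    -- The random upper limit is moved into an indicator on `Ω × ℝ`, so that measurability of
    -- parametric integrals applies.
    set S : Set (Ω × ℝ) := {p | (t : ℝ) < p.2 ∧ p.2 ≤ σ p.1} with hS
    have hSm : MeasurableSet S := (measurableSet_lt measurable_const measurable_snd).inter
      (measurableSet_le measurable_snd (hσ.comp measurable_fst).coe_nnreal_real)
    have hF : Measurable (S.indicator fun p : Ω × ℝ =>
        deriv (fun u : ℝ => (1 - u)⁻¹) p.2 * W p.2.toNNReal p.1) := by
      refine Measurable.indicator (Measurable.mul ((measurable_deriv _).comp measurable_snd) ?_) hSm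
      exact hW.comp (measurable_snd.real_toNNReal.prodMk measurable_fst)
    have h := (hF.stronglyMeasurable.integral_prod_right' (ν := volume)).measurable
    convert h using 2 with ω
    rw [intervalIntegral.integral_of_le (NNReal.coe_le_coe.2 (htσ ω)),
      ← integral_indicator measurableSet_Ioc]
    rfl
  unfold wienerIntegral
  fun_prop

theorem aemeasurable_brownianBridge_comp {P : Measure Ω} [P.IsComplete] {W : ℝ≥0 → Ω → ℝ}
    (hW : IsBrownianReal W P) {t : ℝ≥0} (x : ℝ) {σ : Ω → ℝ≥0} (hσ : Measurable σ)
    (htσ : ∀ ω, t ≤ σ ω) : AEMeasurable (fun ω => brownianBridge W t x (σ ω) ω) P := by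
  classical
  set C : Set Ω := {ω | Continuous (W · ω)} with hC
  have hCm : MeasurableSet C := by
    rw [← compl_compl C]
    exact (Measure.IsComplete.out' Cᶜ hW.cont).compl
  -- Setting the discontinuous paths to zero changes `W` on a null set only and makes it jointly
  -- measurable.
  set V : ℝ≥0 → Ω → ℝ := fun s => C.indicator (W s) with hV
  have hVm : Measurable (Function.uncurry V) := by
    refine measurable_uncurry_of_continuous_of_measurable (fun ω => ?_) fun s =>
      (measurable_of_isPreBrownianReal hW.toIsPreBrownianReal s).indicator hCm
    by_cases hω : ω ∈ C
    · simp only [hV, Set.indicator_of_mem hω]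
      exact hω
    · simpa [hV, hω] using continuous_const
  refine (measurable_brownianBridge_comp hVm x hσ htσ).aemeasurable.congr ?_
  filter_upwards [hW.cont] with ω hω
  have : ∀ s, V s ω = W s ω := fun s => Set.indicator_of_mem (show ω ∈ C from hω) _
  simp only [brownianBridge, wienerIntegral, this]

theorem IsAdmissible.measurable {P : Measure Ω} [P.IsComplete] {W : ℝ≥0 → Ω → ℝ}
    {hW : IsBrownianReal W P} {t : ℝ≥0} {τ : Ω → ℝ≥0} (hτ : IsAdmissible hW t τ) :
    Measurable fun ω => t + τ ω := by
  refine measurable_of_Iic fun i => ?_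
  have h := (augmentedFiltration hW).le i _ (hτ.2 i)
  simp only [WithTop.coe_le_coe] at h
  exact h

/-! ### Properties of the value function. -/

/-- The expected gain of the random time `τ`. -/
noncomputable def gain (P : Measure Ω) (W : ℝ≥0 → Ω → ℝ) (t : ℝ≥0) (x : ℝ) (τ : Ω → ℝ≥0) : ℝ≥0∞ :=
  ∫⁻ ω, ENNReal.ofReal (Real.exp (brownianBridge W t x (t + τ ω) ω)) ∂P

section Value

variable {P : Measure Ω} [P.IsComplete] {W : ℝ≥0 → Ω → ℝ} (hW : IsBrownianReal W P)

theorem aemeasurable_gain {t : ℝ≥0} (x : ℝ) {τ : Ω → ℝ≥0}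
    (hτ : IsAdmissible hW t τ) : AEMeasurable
      (fun ω => ENNReal.ofReal (Real.exp (brownianBridge W t x (t + τ ω) ω))) P :=
  ENNReal.measurable_ofReal.comp_aemeasurable (Real.measurable_exp.comp_aemeasurable
    (aemeasurable_brownianBridge_comp hW x hτ.measurable fun _ => le_self_add))

theorem gain_le_extendedValue {t : ℝ≥0} (x : ℝ) {τ : Ω → ℝ≥0} (hτ : IsAdmissible hW t τ) :
    gain P W t x τ ≤ extendedValue hW t x :=
  le_iSup₂ (f := fun (τ : Ω → ℝ≥0) (_ : IsAdmissible hW t τ) => gain P W t x τ) τ hτ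

theorem gain_zero_le_c₁ [IsProbabilityMeasure P] {t : ℝ≥0} {τ : Ω → ℝ≥0}
    (hτ : IsAdmissible hW t τ) : gain P W t 0 τ ≤ ENNReal.ofReal (c₁ W P) :=
  (lintegral_exp_bridge_zero_le hW _ (fun _ => le_self_add) hτ.1).trans
    (ENNReal.ofReal_le_ofReal (le_c₁ hW))

theorem extendedValue_lt_top [IsProbabilityMeasure P] (t : ℝ≥0) (x : ℝ) :
    extendedValue hW t x < ∞ := by
  have h : extendedValue hW t x ≤ ENNReal.ofReal (Real.exp |x|) * ENNReal.ofReal (c₁ W P) := by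
    refine iSup₂_le fun τ hτ => ?_
    refine le_trans ?_ (mul_le_mul_right (gain_zero_le_c₁ hW hτ) _)
    rw [gain, ← lintegral_const_mul' _ _ ENNReal.ofReal_ne_top]
    refine lintegral_mono fun ω => ?_
    rw [← ENNReal.ofReal_mul (Real.exp_pos _).le, ← Real.exp_add, brownianBridge_eq]
    refine ENNReal.ofReal_le_ofReal (Real.exp_le_exp.2 (add_le_add_left ?_ _))
    have h0 := bridgeSlope_nonneg (t := t) (hτ.1 ω)
    have h1 := bridgeSlope_le_one (t := t) (s := t + τ ω) le_self_add
    exact (mul_le_mul_of_nonneg_left (le_abs_self x) h0).trans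
      (mul_le_of_le_one_left (abs_nonneg x) h1)
  exact h.trans_lt (ENNReal.mul_lt_top ENNReal.ofReal_lt_top ENNReal.ofReal_lt_top)

theorem monotone_value [IsProbabilityMeasure P] (t : ℝ≥0) :
    Monotone fun x => value hW t x := fun x y hxy => by
  refine ENNReal.toReal_mono (extendedValue_lt_top hW t y).ne (iSup₂_mono fun τ hτ => ?_)
  refine lintegral_mono fun ω => ENNReal.ofReal_le_ofReal (Real.exp_le_exp.2 ?_)
  rw [brownianBridge_eq W t _ x, brownianBridge_eq W t _ y]
  exact add_le_add_left (mul_le_mul_of_nonneg_left hxy (bridgeSlope_nonneg (hτ.1 ω))) _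

theorem convexOn_value [IsProbabilityMeasure P] (t : ℝ≥0) :
    ConvexOn ℝ Set.univ fun x => value hW t x := by
  refine ⟨convex_univ, fun x _ y _ a b ha hb hab => ?_⟩
  have hfin := fun z => (extendedValue_lt_top hW t z).ne
  have h : extendedValue hW t (a • x + b • y) ≤
      ENNReal.ofReal a * extendedValue hW t x + ENNReal.ofReal b * extendedValue hW t y := by
    refine iSup₂_le fun τ hτ => ?_
    refine le_trans ?_ (add_le_add (mul_le_mul_right (gain_le_extendedValue hW x hτ) _)
      (mul_le_mul_right (gain_le_extendedValue hW y hτ) _))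
    rw [gain, gain, ← lintegral_const_mul' _ _ ENNReal.ofReal_ne_top,
      ← lintegral_const_mul' _ _ ENNReal.ofReal_ne_top,
      ← lintegral_add_left' ((aemeasurable_gain hW x hτ).const_mul _)]
    refine lintegral_mono fun ω => ?_
    rw [← ENNReal.ofReal_mul ha, ← ENNReal.ofReal_mul hb,
      ← ENNReal.ofReal_add (by positivity) (by positivity)]
    refine ENNReal.ofReal_le_ofReal ?_
    have hc := convexOn_exp.2 (Set.mem_univ (brownianBridge W t x (t + τ ω) ω))
      (Set.mem_univ (brownianBridge W t y (t + τ ω) ω)) ha hb hab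
    refine le_trans (le_of_eq ?_) hc
    rw [brownianBridge_eq, brownianBridge_eq W t _ x, brownianBridge_eq W t _ y]
    congr 1
    obtain rfl : b = 1 - a := by linarith
    simp only [smul_eq_mul]
    ring
  have h2 := ENNReal.toReal_mono (ENNReal.add_ne_top.2
    ⟨ENNReal.mul_ne_top ENNReal.ofReal_ne_top (hfin x),
      ENNReal.mul_ne_top ENNReal.ofReal_ne_top (hfin y)⟩) h
  rw [ENNReal.toReal_add (ENNReal.mul_ne_top ENNReal.ofReal_ne_top (hfin x))
    (ENNReal.mul_ne_top ENNReal.ofReal_ne_top (hfin y)), ENNReal.toReal_mul, ENNReal.toReal_mul,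
    ENNReal.toReal_ofReal ha, ENNReal.toReal_ofReal hb] at h2
  exact h2

/-- Every `τ` gains at `y` at most its gain at `x` plus `m (y - x)` times its gain at 0, and the
last gain is at most `c₁`. -/
theorem value_sub_le [IsProbabilityMeasure P] (t : ℝ≥0) {x y m : ℝ}
    (hxy : x ≤ y) (hm : Real.exp |y| ≤ m) :
    value hW t y - value hW t x ≤ c₁ W P * m * (y - x) := by
  have hc : 0 ≤ c₁ W P := integral_nonneg fun ω => (Real.exp_pos _).le
  have hm0 : 0 ≤ m := (Real.exp_pos _).le.trans hm
  have hd : 0 ≤ m * (y - x) := mul_nonneg hm0 (sub_nonneg.2 hxy)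
  have h : extendedValue hW t y ≤
      extendedValue hW t x + ENNReal.ofReal (m * (y - x)) * ENNReal.ofReal (c₁ W P) := by
    refine iSup₂_le fun τ hτ => ?_
    refine le_trans ?_ (add_le_add (gain_le_extendedValue hW x hτ)
      (mul_le_mul_right (gain_zero_le_c₁ hW hτ) _))
    rw [gain, gain, ← lintegral_const_mul' _ _ ENNReal.ofReal_ne_top,
      ← lintegral_add_left' (aemeasurable_gain hW x hτ)]
    refine lintegral_mono fun ω => ?_
    rw [← ENNReal.ofReal_mul hd, ← ENNReal.ofReal_add (Real.exp_pos _).le (by positivity)]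
    refine ENNReal.ofReal_le_ofReal ?_
    rw [brownianBridge_eq W t _ x, brownianBridge_eq W t _ y, Real.exp_add, Real.exp_add,
      ← add_mul]
    refine mul_le_mul_of_nonneg_right ?_ (Real.exp_pos _).le
    have h0 := bridgeSlope_nonneg (t := t) (hτ.1 ω)
    have h1 := bridgeSlope_le_one (t := t) (s := t + τ ω) le_self_add
    set r := bridgeSlope t (t + τ ω)
    have h2 : Real.exp (r * y) ≤ m := (Real.exp_le_exp.2
      ((mul_le_mul_of_nonneg_left (le_abs_self y) h0).trans
        (mul_le_of_le_one_left (abs_nonneg y) h1))).trans hm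
    -- Tangent line of `exp` at `r * y`: `exp (r y) - exp (r x) ≤ exp (r y) r (y - x)`.
    have h3 := Real.add_one_le_exp (r * x - r * y)
    have h4 : Real.exp (r * x) = Real.exp (r * y) * Real.exp (r * x - r * y) := by
      rw [← Real.exp_add]
      ring_nf
    have h5 := mul_le_mul_of_nonneg_left h3 (Real.exp_pos (r * y)).le
    have h6 : r * (y - x) ≤ y - x := mul_le_of_le_one_left (sub_nonneg.2 hxy) h1
    have h7 : 0 ≤ r * (y - x) := mul_nonneg h0 (sub_nonneg.2 hxy)
    have h8 : Real.exp (r * y) * (r * (y - x)) ≤ m * (y - x) := by gcongr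
    rw [h4]
    nlinarith
  have hne : ENNReal.ofReal (m * (y - x)) * ENNReal.ofReal (c₁ W P) ≠ ∞ :=
    ENNReal.mul_ne_top ENNReal.ofReal_ne_top ENNReal.ofReal_ne_top
  have hx := (extendedValue_lt_top hW t x).ne
  have h2 := ENNReal.toReal_mono (ENNReal.add_ne_top.2 ⟨hx, hne⟩) h
  rw [ENNReal.toReal_add hx hne, ENNReal.toReal_mul, ENNReal.toReal_ofReal hd,
    ENNReal.toReal_ofReal hc] at h2
  unfold value
  linarith

theorem abs_value_sub_le [IsProbabilityMeasure P] (t : ℝ≥0) {x y m : ℝ}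
    (hx : Real.exp |x| ≤ m) (hy : Real.exp |y| ≤ m) :
    |value hW t y - value hW t x| ≤ c₁ W P * m * |y - x| := by
  wlog hxy : x ≤ y generalizing x y
  · rw [abs_sub_comm, abs_sub_comm y]
    exact this hy hx (le_of_not_ge hxy)
  rw [abs_of_nonneg (sub_nonneg.2 (monotone_value hW t hxy)), abs_of_nonneg (sub_nonneg.2 hxy)]
  exact value_sub_le hW t hxy hy

end Value

end BridgeStopping

theorem mainTheorem8 {Ω : Type*} {mΩ : MeasurableSpace Ω} {P : Measure Ω}
    [IsProbabilityMeasure P] [P.IsComplete] {W : ℝ≥0 → Ω → ℝ} (hW : IsBrownianReal W P) :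
    -- the objects are well defined: `v` and `c₁` are finite
    (∀ t : ℝ≥0, t ≤ 1 → ∀ x : ℝ, BridgeStopping.extendedValue hW t x < ∞) ∧
    Integrable (fun ω => Real.exp (BridgeStopping.supAbs W ω)) P ∧
    -- convexity and monotonicity in `x`
    (∀ t : ℝ≥0, t ≤ 1 →
      ConvexOn ℝ Set.univ (fun x => BridgeStopping.value hW t x) ∧
      Monotone (fun x => BridgeStopping.value hW t x)) ∧
    -- Lipschitz continuity on compacts, uniformly in `t`
    (∀ K : Set ℝ, IsCompact K → ∃ L : ℝ, 0 < L ∧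
      (K.Nonempty → L = BridgeStopping.c₁ W P * sSup ((fun x => Real.exp |x|) '' K)) ∧
      ∀ t : ℝ≥0, t ≤ 1 → ∀ x ∈ K, ∀ y ∈ K,
        |BridgeStopping.value hW t y - BridgeStopping.value hW t x| ≤ L * |y - x|) := by
  refine ⟨fun t _ x => BridgeStopping.extendedValue_lt_top hW t x,
    BridgeStopping.integrable_exp_supAbs hW,
    fun t _ => ⟨BridgeStopping.convexOn_value hW t, BridgeStopping.monotone_value hW t⟩,
    fun K hK => ?_⟩
  rcases K.eq_empty_or_nonempty with rfl | hne
  · exact ⟨1, one_pos, fun h => absurd h Set.not_nonempty_empty, fun _ _ _ hx => hx.elim⟩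
  have hbdd : BddAbove ((fun x => Real.exp |x|) '' K) :=
    (hK.image (by fun_prop)).bddAbove
  have hle : ∀ x ∈ K, Real.exp |x| ≤ sSup ((fun x => Real.exp |x|) '' K) := fun x hx =>
    le_csSup hbdd ⟨x, hx, rfl⟩
  have hc : 0 < BridgeStopping.c₁ W P :=
    lt_of_lt_of_le (by positivity) (BridgeStopping.le_c₁ hW)
  obtain ⟨z, hz⟩ := hne
  exact ⟨_, mul_pos hc ((Real.exp_pos _).trans_le (hle z hz)), fun _ => rfl,
    fun t _ x hx y hy => BridgeStopping.abs_value_sub_le hW t (hle x hx) (hle y hy)⟩
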